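/- Let $(L,\preceq)$ be a lattice with least element $0$. A \emph{filter} of $L$ is a nonempty proper subset $F\subsetneq L$ that is closed upwards and under $\wedge$. An element $x\in L$ is \emph{internal} for $a,b\in L$ if $x\preceq a\vee b$ and $(a\wedge x)\vee(b\wedge x)\neq x$. A filter $F$ is \emph{semi-prime} if, whenever $a\vee b\in F$, we have $a\in F$ or $b\in F$ or some internal element of $a,b$ is in $F$. Let $X_L$ be the set of semi-prime filters of $L$, let $f:L\to\wp(X_L)$, $f(x)=\{F\in X_L: x\in F\}$, be the Stone map, and let $\tau$ be the Stone topology on $X_L$, i.e. the topology with basis $f(L)$. $L$ is a \emph{loc-lattice} if (1) for all $a,b,c\in L$: $a\preceq b\vee c$ or $b\preceq a\vee c$ or $c\preceq a\vee b$; (2) if $a,b,x$ are pairwise incomparable and $x\preceq a\vee b$, then $(a\vee x)\wedge(b\vee x)=x$; (3) if $x\preceq a\vee b$, $a\wedge x\ne0$ and $b\wedge x\neq 0$, then $(a\wedge x)\vee(b\wedge x)=x$. $L$ is \emph{totally separated} if for any two distinct semi-prime filters $F,G$ there are $a\in F$, $b\in G$ with $a\wedge b=0$. An element $a\in L$ is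 \emph{inaccessible from above} if there is no nonempty chain $A\subseteq L$ with $a\notin A$ and $\bigwedge A=a$. A linear order $\leq$ on $X_L$ is \emph{$f(L)$-consistent} if, whenever $F\le G\le H$ or $H\le G\le F$ in $X_L$, every set $f(x)$ containing $F$ and $H$ contains $G$. \textbf{Lemma.} Let $L$ be a totally separated loc-lattice in which every element $a\neq 0$ is inaccessible from above. Then there is an $f(L)$-consistent linear order on $X_L$, it is unique up to reversal, and for every $f(L)$-consistent linear order $\le$ on $X_L$ the space $(X_L,\tau)$ is a complete linearly ordered topological space with respect to $\leq$: the open intervals of $(X_L,\le)$ (the sets $\{x: a<x<b\}$, $\{x:a<x\}$, $\{x:x<b\}$ and $X_L$) form a basis of $\tau$, and every nonempty subset of $X_L$ that is bounded above has a supremum. -/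

import Mathlib

open Set

/-- Two elements of a poset are incomparable. -/
def LatIncomp {L : Type*} [LE L] (a b : L) : Prop := ¬ a ≤ b ∧ ¬ b ≤ a

/-- Loc-lattices (with least element `⊥`). -/
structure IsLocLattice (L : Type*) [Lattice L] [OrderBot L] : Prop where
  le_sup_or : ∀ a b c : L, a ≤ b ⊔ c ∨ b ≤ a ⊔ c ∨ c ≤ a ⊔ b
  inf_sup_eq : ∀ a b x : L, LatIncomp a b → LatIncomp a x → LatIncomp b x →
    x ≤ a ⊔ b → (a ⊔ x) ⊓ (b ⊔ x) = x
  sup_inf_eq : ∀ a b x : L, x ≤ a ⊔ b → a ⊓ x ≠ ⊥ → b ⊓ x ≠ ⊥ →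
    (a ⊓ x) ⊔ (b ⊓ x) = x

/-- `x` is an internal element of `a, b`. -/
def IsInternal {L : Type*} [Lattice L] (a b x : L) : Prop :=
  x ≤ a ⊔ b ∧ (a ⊓ x) ⊔ (b ⊓ x) ≠ x

/-- Semi-prime filters: proper (nonempty) filters `F` such that whenever `a ⊔ b ∈ F`, one of
`a`, `b` or some internal element of `a, b` lies in `F`. -/
structure IsSemiPrime {L : Type*} [Lattice L] (F : Order.PFilter L) : Prop where
  proper : (F : Set L) ≠ univ
  mem_of_sup_mem : ∀ a b : L, a ⊔ b ∈ F → a ∈ F ∨ b ∈ F ∨ ∃ c ∈ F, IsInternal a b c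

/-- The set of all semi-prime filters of a lattice. -/
def StoneSpace (L : Type*) [Lattice L] : Type _ := {F : Order.PFilter L // IsSemiPrime F}

/-- The Stone map `x ↦ {F | x ∈ F}`. -/
def stoneMap {L : Type*} [Lattice L] (x : L) : Set (StoneSpace L) := {F | x ∈ F.1}

/-- The Stone topology; the range of the Stone map is a basis, see the next theorem. -/
instance stoneTopology (L : Type*) [Lattice L] : TopologicalSpace (StoneSpace L) :=
  TopologicalSpace.generateFrom (range (stoneMap (L := L)))

theorem isTopologicalBasis_range_stoneMap (L : Type*) [Lattice L] :
    TopologicalSpace.IsTopologicalBasis (range (stoneMap (L := L))) where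
  exists_subset_inter := by
    rintro _ ⟨a, rfl⟩ _ ⟨b, rfl⟩ F ⟨ha, hb⟩
    refine ⟨_, ⟨a ⊓ b, rfl⟩, Order.PFilter.inf_mem ha hb, fun G hG => ⟨?_, ?_⟩⟩
    · exact Order.PFilter.mem_of_le inf_le_left hG
    · exact Order.PFilter.mem_of_le inf_le_right hG
  sUnion_eq := by
    refine eq_univ_of_forall fun F => ?_
    obtain ⟨a, ha⟩ := F.1.nonempty
    exact ⟨_, ⟨a, rfl⟩, ha⟩
  eq_generateFrom := rfl

/-- Any two distinct semi-prime filters contain disjoint elements. -/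
def IsTotallySeparatedLattice (L : Type*) [Lattice L] [OrderBot L] : Prop :=
  ∀ F G : StoneSpace L, F ≠ G → ∃ a ∈ F.1, ∃ b ∈ G.1, a ⊓ b = ⊥

/-- `a` is accessible from above: it is the infimum, in the poset, of a nonempty chain
that does not contain `a`. -/
def AccessibleFromAbove {L : Type*} [PartialOrder L] (a : L) : Prop :=
  ∃ A : Set L, A.Nonempty ∧ IsChain (· ≤ ·) A ∧ IsGLB A a ∧ a ∉ A

/-- `b` is between `a` and `c` with respect to the family `M` of subsets of `X`. -/
def FamilyBetween {X : Type*} (M : Set (Set X)) (a b c : X) : Prop :=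
  ∀ A ∈ M, a ∈ A → c ∈ A → b ∈ A

/-- `M`-consistent linear orders: order betweenness implies betweenness for `M`. -/
def IsConsistentOrder {X : Type*} (M : Set (Set X)) (o : LinearOrder X) : Prop :=
  ∀ a b c : X, (o.le a b ∧ o.le b c) ∨ (o.le c b ∧ o.le b a) → FamilyBetween M a b c

/-- The open intervals of a linearly ordered set. -/
def openIntervals (X : Type*) [LinearOrder X] : Set (Set X) :=
  {I | I = univ ∨ (∃ a, I = Ioi a) ∨ (∃ a, I = Iio a) ∨ ∃ a b, I = Ioo a b}

/-- Complete linearly ordered topological spaces: the open intervals are a basis of the topology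
and the order is Dedekind complete. -/
structure IsCompleteLinearlyOrderedSpace (X : Type*) [TopologicalSpace X] [LinearOrder X] :
    Prop where
  isBasis : TopologicalSpace.IsTopologicalBasis (openIntervals X)
  exists_isLUB : ∀ S : Set X, S.Nonempty → BddAbove S → ∃ s, IsLUB S s

/-! ### Linear orders from an abstract betweenness. -/

section Betweenness

variable {X : Type*} {M : Set (Set X)}

/-! The basic sets define a betweenness on the semi-prime filters. The loc-lattice axioms and total
separation make it an `IsLinearBetweenness`, and such a betweenness comes from a linear order,
unique up to reversal.

For a consistent order the Stone map represents the lattice by convex sets, with joins as convex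
hulls (`IsConvexRepresentation`). If the image of `x ≠ ⊥` stopped exactly at a cut whose other side
has no nearest point, the joins of `x` with smaller and smaller elements beyond the cut would form a
chain with infimum `x` (`accessibleFromAbove`). Inaccessibility therefore makes the images open in
the order topology. It also makes the filter of elements straddling a gap semi-prime; as a point,
this filter would have to lie on one side of the gap, which is impossible, so there are no gaps. -/

theorem FamilyBetween.symm {a b c : X} (h : FamilyBetween M a b c) : FamilyBetween M c b a :=
  fun A hA hc ha => h A hA ha hc

theorem FamilyBetween.trans {p x y z : X} (h : FamilyBetween M p x y)
    (h' : FamilyBetween M p y z) : FamilyBetween M p x z :=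
  fun A hA hp hz => h A hA hp (h' A hA hp hz)

theorem FamilyBetween.refl_left (a b : X) : FamilyBetween M a a b := fun _ _ h _ => h

theorem FamilyBetween.refl_right (a b : X) : FamilyBetween M a b b := fun _ _ _ h => h

/-- The betweenness of `M` is total, has at most one middle point for each triple, and every
point separating `a` from `c` separates any further point from `a` or from `c`. -/
structure IsLinearBetweenness (M : Set (Set X)) : Prop where
  total : ∀ a b c : X, FamilyBetween M a b c ∨ FamilyBetween M b c a ∨ FamilyBetween M c a b
  unique : ∀ a b c : X, FamilyBetween M a b c → FamilyBetween M a c b → b = c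
  split : ∀ a b c x : X, FamilyBetween M a b c → FamilyBetween M a b x ∨ FamilyBetween M x b c

/-- A point cannot separate three other points pairwise. -/
theorem IsLinearBetweenness.eq_of_separates (h : IsLinearBetweenness M) {p a b c : X}
    (hab : FamilyBetween M a p b) (hbc : FamilyBetween M b p c) (hac : FamilyBetween M a p c) :
    a = p ∨ b = p ∨ c = p := by
  -- The middle one of the three points separates `p` from one of the other two; as `p` also
  -- separates it from that point, uniqueness identifies it with `p`.
  rcases h.total a b c with h1 | h1 | h1
  · rcases h.split _ _ _ p h1 with h2 | h2
    · exact Or.inr (Or.inl (h.unique _ _ _ h2 hab))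
    · exact Or.inr (Or.inl (h.unique _ _ _ h2.symm hbc.symm))
  · rcases h.split _ _ _ p h1 with h2 | h2
    · exact Or.inr (Or.inr (h.unique _ _ _ h2 hbc))
    · exact Or.inr (Or.inr (h.unique _ _ _ h2.symm hac))
  · rcases h.split _ _ _ p h1 with h2 | h2
    · exact Or.inl (h.unique _ _ _ h2 hac.symm)
    · exact Or.inl (h.unique _ _ _ h2.symm hab.symm)

/-- A base point `p` cuts the space into the side of a second point `q` and the rest. Points of the
rest come first, ordered towards `p`; points on the side of `q` follow, ordered away from `p`. -/
theorem IsLinearBetweenness.exists_isConsistentOrder (h : IsLinearBetweenness M) :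
    ∃ o : LinearOrder X, IsConsistentOrder M o := by
  classical
  by_cases hX : Subsingleton X
  · refine ⟨{ le := fun _ _ => True
              le_refl := fun _ => trivial
              le_trans := fun _ _ _ _ _ => trivial
              le_antisymm := fun a b _ _ => Subsingleton.elim a b
              le_total := fun _ _ => Or.inl trivial
              toDecidableLE := Classical.decRel _ }, ?_⟩
    intro a b c _
    rw [Subsingleton.elim b a]
    exact .refl_left _ _
  have : Nontrivial X := not_subsingleton_iff_nontrivial.1 hX
  obtain ⟨p, q, hpq⟩ := exists_pair_ne X
  -- the points strictly on the side of `q`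
  obtain ⟨P, hP⟩ : ∃ P : X → Prop, ∀ x, P x ↔ ¬ FamilyBetween M x p q := ⟨_, fun _ => Iff.rfl⟩
  have hPp : ¬ P p := by simpa [hP] using FamilyBetween.refl_left p q
  have hPN : ∀ {x y}, ¬ P x → P y → FamilyBetween M x p y := by
    intro x y hx hy
    rw [hP, not_not] at hx
    rw [hP] at hy
    exact (h.split _ _ _ y hx).resolve_right hy
  have hPP : ∀ {x y}, P x → P y → ¬ FamilyBetween M x p y := by
    intro x y hx hy hxy
    rw [hP] at hx hy
    exact (h.split _ _ _ q hxy).elim hx fun h' => hy h'.symm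
  have hNN : ∀ {x y}, ¬ P x → ¬ P y → FamilyBetween M x p y → x = p ∨ y = p := by
    intro x y hx hy hxy
    rw [hP, not_not] at hx hy
    rcases h.eq_of_separates hxy hy hx with h1 | h1 | h1
    exacts [Or.inl h1, Or.inr h1, absurd h1.symm hpq]
  let le : X → X → Prop := fun x y => (¬ P x ∧ P y) ∨ (P x ∧ P y ∧ FamilyBetween M p x y) ∨
    (¬ P x ∧ ¬ P y ∧ FamilyBetween M x y p)
  have hcons : ∀ {x y z}, le x y → le y z → FamilyBetween M x y z := by
    rintro x y z (⟨hx, hy⟩ | ⟨hx, hy, hxy⟩ | ⟨hx, hy, hxy⟩)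
      (⟨hy', hz⟩ | ⟨hy', hz, hyz⟩ | ⟨hy', hz, hyz⟩)
    · exact absurd hy hy'
    -- If `y` separated `x` from `p`, then `y = p`, because `p` separates `x` from `y`. So `y`
    -- separates `x` from `z`.
    · rcases h.split _ _ _ x hyz with h1 | h1
      · exact absurd (h.unique _ _ _ h1.symm (hPN hx hy) ▸ hy) hPp
      · exact h1
    · exact absurd hy hy'
    · exact absurd hy hy'
    · rcases h.split _ _ _ x hyz with h1 | h1
      · rw [h.unique _ _ _ hxy h1]
        exact .refl_left _ _
      · exact h1
    · exact absurd hy hy'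
    · rcases h.split _ _ _ z hxy with h1 | h1
      · exact h1
      · obtain rfl := h.unique _ _ _ h1 (hPN hy hz).symm
        exact hPN hx hz
    · exact absurd hy' hy
    · rcases h.split _ _ _ z hxy.symm with h1 | h1
      · rw [h.unique _ _ _ h1 hyz.symm]
        exact .refl_right _ _
      · exact h1.symm
  refine ⟨{ le := le
            le_refl := ?_
            le_trans := ?_
            le_antisymm := ?_
            le_total := ?_
            toDecidableLE := Classical.decRel _ }, ?_⟩
  · intro x
    by_cases hx : P x
    · exact Or.inr (Or.inl ⟨hx, hx, .refl_right _ _⟩)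
    · exact Or.inr (Or.inr ⟨hx, hx, .refl_left _ _⟩)
  · rintro x y z (⟨hx, hy⟩ | ⟨hx, hy, hxy⟩ | ⟨hx, hy, hxy⟩)
      (⟨hy', hz⟩ | ⟨hy', hz, hyz⟩ | ⟨hy', hz, hyz⟩)
    any_goals contradiction
    · exact Or.inl ⟨hx, hz⟩
    · exact Or.inr (Or.inl ⟨hx, hz, hxy.trans hyz⟩)
    · exact Or.inl ⟨hx, hz⟩
    · exact Or.inr (Or.inr ⟨hx, hz, (hyz.symm.trans hxy.symm).symm⟩)
  · rintro x y (⟨hx, hy⟩ | ⟨hx, hy, hxy⟩ | ⟨hx, hy, hxy⟩)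
      (⟨hy', hz⟩ | ⟨hy', hz, hyz⟩ | ⟨hy', hz, hyz⟩)
    any_goals contradiction
    · exact h.unique _ _ _ hxy hyz
    · exact h.unique _ _ _ hyz.symm hxy.symm
  · intro x y
    by_cases hx : P x <;> by_cases hy : P y
    · rcases h.total p x y with h1 | h1 | h1
      · exact Or.inl (Or.inr (Or.inl ⟨hx, hy, h1⟩))
      · exact Or.inr (Or.inr (Or.inl ⟨hy, hx, h1.symm⟩))
      · exact absurd h1 (hPP hy hx)
    · exact Or.inr (Or.inl ⟨hy, hx⟩)
    · exact Or.inl (Or.inl ⟨hx, hy⟩)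
    · rcases h.total p x y with h1 | h1 | h1
      · exact Or.inr (Or.inr (Or.inr ⟨hy, hx, h1.symm⟩))
      · exact Or.inl (Or.inr (Or.inr ⟨hx, hy, h1⟩))
      · rcases hNN hy hx h1 with rfl | rfl
        · exact Or.inl (Or.inr (Or.inr ⟨hx, hy, .refl_right _ _⟩))
        · exact Or.inr (Or.inr (Or.inr ⟨hy, hx, .refl_right _ _⟩))
  · rintro a b c (⟨hab, hbc⟩ | ⟨hcb, hba⟩)
    · exact hcons hab hbc
    · exact (hcons hcb hba).symm

/-- Two orders agree on the pairs from `{x, y}` and from `{x, z}` simultaneously. -/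
theorem IsLinearBetweenness.le_iff_le_iff (h : IsLinearBetweenness M) {o o' : LinearOrder X}
    (ho : IsConsistentOrder M o) (ho' : IsConsistentOrder M o') {x y z : X}
    (hxy : x ≠ y) (hxz : x ≠ z) (hxy' : o.le x y ↔ o'.le x y) : o.le x z ↔ o'.le x z := by
  by_cases hyz : y = z
  · exact hyz ▸ hxy'
  -- Otherwise `x` lies between `y` and `z` in one order and on one side of both in the other; the
  -- two resulting betweenness relations violate uniqueness.
  have key : ∀ {r s : LinearOrder X}, IsConsistentOrder M r → IsConsistentOrder M s →
      (r.le x y ↔ s.le x y) → r.le x z → ¬ s.le x z → False := by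
    intro r s hr hs e h1 h2
    have h2' := (s.le_total x z).resolve_left h2
    by_cases h3 : r.le x y
    · have h4 := hs z x y (Or.inl ⟨h2', e.1 h3⟩)
      rcases r.le_total y z with h5 | h5
      · exact hxy (h.unique z x y h4 (hr _ _ _ (Or.inr ⟨h3, h5⟩)))
      · exact hxz (h.unique y x z h4.symm (hr _ _ _ (Or.inr ⟨h1, h5⟩)))
    · have h3' := (r.le_total x y).resolve_left h3
      have h6 := (s.le_total x y).resolve_left (fun h => h3 (e.2 h))
      have h4 := hr y x z (Or.inl ⟨h3', h1⟩)
      rcases s.le_total y z with h5 | h5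
      · exact hxz (h.unique y x z h4 (hs _ _ _ (Or.inl ⟨h5, h2'⟩)))
      · exact hxy (h.unique z x y h4.symm (hs _ _ _ (Or.inl ⟨h5, h6⟩)))
  constructor
  · exact fun h1 => by_contra fun h2 => key ho ho' hxy' h1 h2
  · exact fun h1 => by_contra fun h2 => key ho' ho hxy'.symm h1 h2

theorem LinearOrder.le_iff_not_le (o : LinearOrder X) {x y : X} (hxy : x ≠ y) :
    o.le x y ↔ ¬ o.le y x :=
  ⟨fun h h' => hxy (o.le_antisymm _ _ h h'), fun h => (o.le_total x y).resolve_right h⟩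

/-- Agreement on one pair of distinct points spreads through shared endpoints to all pairs, so two
orders agree everywhere or on no such pair. -/
theorem IsLinearBetweenness.eq_or_eq_dual (h : IsLinearBetweenness M) {o o' : LinearOrder X}
    (ho : IsConsistentOrder M o) (ho' : IsConsistentOrder M o') :
    (∀ x y, o.le x y ↔ o'.le x y) ∨ (∀ x y, o.le x y ↔ o'.le y x) := by
  by_contra hne
  simp only [not_or, not_forall] at hne
  obtain ⟨⟨a, b, hab⟩, c, d, hcd⟩ := hne
  have hne : a ≠ b := by
    rintro rfl
    exact hab (iff_of_true (o.le_refl a) (o'.le_refl a))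
  have hne' : c ≠ d := by
    rintro rfl
    exact hcd (iff_of_true (o.le_refl c) (o'.le_refl c))
  have flip : ∀ {x y}, (o.le x y ↔ o'.le x y) → (o.le y x ↔ o'.le y x) := by
    intro x y e
    by_cases hxy : x = y
    · subst hxy
      exact e
    · rw [o.le_iff_not_le (Ne.symm hxy), o'.le_iff_not_le (Ne.symm hxy), e]
  have hcd' : o.le c d ↔ o'.le c d := by
    have := o'.le_iff_not_le hne'
    tauto
  refine hab ?_
  by_cases hac : a = c
  · subst hac
    exact h.le_iff_le_iff ho ho' hne' hne hcd'
  · have hca := flip (h.le_iff_le_iff ho ho' hne' (Ne.symm hac) hcd')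
    exact h.le_iff_le_iff ho ho' hac hne hca

end Betweenness

/-! ### Semi-prime filters and the betweenness of the Stone map. -/

section SemiPrime

variable {L : Type*} [Lattice L]

/-- The filter generated by a filter and an element. -/
def filterAdjoin (F : Order.PFilter L) (a : L) : Order.PFilter L :=
  Order.IsPFilter.toPFilter (F := {z | ∃ c ∈ F, c ⊓ a ≤ z}) <| by
    refine Order.IsPFilter.of_def ?_ ?_ ?_
    · obtain ⟨c, hc⟩ := F.nonempty
      exact ⟨c, c, hc, inf_le_left⟩
    · rintro x ⟨c, hc, hx⟩ y ⟨d, hd, hy⟩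
      refine ⟨x ⊓ y, ⟨c ⊓ d, Order.PFilter.inf_mem hc hd, le_inf ?_ ?_⟩, inf_le_left, inf_le_right⟩
      · exact (inf_le_inf_right _ inf_le_left).trans hx
      · exact (inf_le_inf_right _ inf_le_right).trans hy
    · rintro x y hxy ⟨c, hc, hx⟩
      exact ⟨c, hc, hx.trans hxy⟩

/-- Any filter avoiding `y` extends to a semi-prime filter avoiding `y`. -/
theorem exists_semiPrime_ge (F : Order.PFilter L) {y : L} (hy : y ∉ F) :
    ∃ G : StoneSpace L, F ≤ G.1 ∧ y ∉ G.1 := by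
  obtain ⟨G, hFG, hG⟩ := zorn_le_nonempty₀ {G : Order.PFilter L | y ∉ G} (by
    intro c hc hchain G₀ hG₀
    have hpf : Order.IsPFilter (⋃ G ∈ c, (G : Set L)) := by
      refine Order.IsPFilter.of_def ?_ ?_ ?_
      · obtain ⟨a, ha⟩ := G₀.nonempty
        exact ⟨a, mem_biUnion hG₀ ha⟩
      · intro x hx z hz
        simp only [mem_iUnion, exists_prop] at hx hz
        obtain ⟨G, hG, hx⟩ := hx
        obtain ⟨H, hH, hz⟩ := hz
        rcases hchain.total hG hH with hle | hle
        · exact ⟨x ⊓ z, mem_biUnion hH (Order.PFilter.inf_mem (hle hx) hz),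
            inf_le_left, inf_le_right⟩
        · exact ⟨x ⊓ z, mem_biUnion hG (Order.PFilter.inf_mem hx (hle hz)),
            inf_le_left, inf_le_right⟩
      · intro x z hxz hx
        simp only [mem_iUnion, exists_prop] at hx ⊢
        obtain ⟨G, hG, hx⟩ := hx
        exact ⟨G, hG, Order.PFilter.mem_of_le hxz hx⟩
    refine ⟨hpf.toPFilter, ?_, ?_⟩
    · intro hmem
      have hmem' : y ∈ ⋃ G ∈ c, (G : Set L) := hmem
      simp only [mem_iUnion, exists_prop] at hmem'
      obtain ⟨G, hG, hyG⟩ := hmem'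
      exact hc hG hyG
    · intro G hG x hx
      exact mem_biUnion hG hx) F hy
  have hadj : ∀ {a}, a ∉ G → ∃ c ∈ G, c ⊓ a ≤ y := by
    intro a ha
    by_contra hc
    have hle : G ≤ filterAdjoin G a := fun z hz => ⟨z, hz, inf_le_left⟩
    have := hG.2 (y := filterAdjoin G a) hc hle
    obtain ⟨c, hc⟩ := G.nonempty
    exact ha (this ⟨c, hc, inf_le_right⟩)
  refine ⟨⟨G, fun huniv => ?_, fun a b hab => ?_⟩, hFG, hG.1⟩
  · exact hG.1 (huniv ▸ mem_univ y : y ∈ (G : Set L))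
  · by_contra! hne
    obtain ⟨c, hc, hca⟩ := hadj hne.1
    obtain ⟨d, hd, hdb⟩ := hadj hne.2.1
    -- This element is internal for `a, b`: otherwise it would be the join of its meets with `a` and
    -- `b`, both below `y`.
    have he : c ⊓ d ⊓ (a ⊔ b) ∈ G := Order.PFilter.inf_mem (Order.PFilter.inf_mem hc hd) hab
    refine hne.2.2 _ he ⟨inf_le_right, fun heq => hG.1 (Order.PFilter.mem_of_le ?_ he)⟩
    rw [← heq]
    refine sup_le (le_trans ?_ hca) (le_trans ?_ hdb)
    · exact le_inf (inf_le_right.trans (inf_le_left.trans inf_le_left)) inf_le_left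
    · exact le_inf (inf_le_right.trans (inf_le_left.trans inf_le_right)) inf_le_left

theorem stoneMap_subset_iff {x y : L} : stoneMap x ⊆ stoneMap y ↔ x ≤ y := by
  refine ⟨fun h => ?_, fun h F hF => Order.PFilter.mem_of_le h hF⟩
  by_contra hxy
  obtain ⟨G, hG, hy⟩ := exists_semiPrime_ge (Order.PFilter.principal x) (y := y)
    (by simpa using hxy)
  exact hy (h (hG (by simp) : x ∈ G.1))

theorem stoneMap_inf (x y : L) : stoneMap (x ⊓ y) = stoneMap x ∩ stoneMap y := by
  ext F
  exact ⟨fun h => ⟨Order.PFilter.mem_of_le inf_le_left h, Order.PFilter.mem_of_le inf_le_right h⟩,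
    fun h => Order.PFilter.inf_mem h.1 h.2⟩

theorem familyBetween_stoneMap_iff {F G H : StoneSpace L} :
    FamilyBetween (range (stoneMap (L := L))) F G H ↔ ∀ x, x ∈ F.1 → x ∈ H.1 → x ∈ G.1 :=
  forall_mem_range

variable [OrderBot L]

theorem bot_notMem (F : StoneSpace L) : ⊥ ∉ F.1 := fun h =>
  F.2.proper (eq_univ_of_forall fun _ => Order.PFilter.mem_of_le bot_le h)

theorem notMem_of_inf_eq_bot (F : StoneSpace L) {a b : L} (ha : a ∈ F.1) (h : a ⊓ b = ⊥) :
    b ∉ F.1 := fun hb => bot_notMem F (h ▸ Order.PFilter.inf_mem ha hb)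

theorem stoneMap_nonempty_iff {x : L} : (stoneMap x).Nonempty ↔ x ≠ ⊥ := by
  rw [Set.nonempty_iff_ne_empty, not_iff_not]
  refine ⟨fun h => le_bot_iff.1 (stoneMap_subset_iff.1 (h ▸ empty_subset _)), ?_⟩
  rintro rfl
  exact eq_empty_of_forall_notMem fun F => bot_notMem F

/-- Otherwise `F` and `x` would generate a proper filter, hence lie in a semi-prime filter strictly
above `F`, and nested filters cannot be separated. -/
theorem IsTotallySeparatedLattice.exists_inf_eq_bot (hsep : IsTotallySeparatedLattice L)
    {F : StoneSpace L} {x : L} (hx : x ∉ F.1) : ∃ c ∈ F.1, c ⊓ x = ⊥ := by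
  by_contra! hne
  obtain ⟨G, hG, -⟩ := exists_semiPrime_ge (filterAdjoin F.1 x) (y := ⊥)
    (fun ⟨c, hc, hcx⟩ => hne c hc (le_bot_iff.1 hcx))
  obtain ⟨c, hc⟩ := F.1.nonempty
  have hxG : x ∈ G.1 := hG ⟨c, hc, inf_le_right⟩
  have hFG : F ≠ G := fun h => hx (h ▸ hxG)
  obtain ⟨a, ha, b, hb, hab⟩ := hsep F G hFG
  exact notMem_of_inf_eq_bot G (hG ⟨a, ha, inf_le_left⟩ : a ∈ G.1) hab hb

theorem IsTotallySeparatedLattice.eq_of_le (hsep : IsTotallySeparatedLattice L)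
    {F G : StoneSpace L} (h : ∀ x ∈ F.1, x ∈ G.1) : F = G := by
  by_contra hne
  obtain ⟨a, ha, b, hb, hab⟩ := hsep F G hne
  exact notMem_of_inf_eq_bot G (h a ha) hab hb

theorem LatIncomp.of_inf_eq_bot {a b : L} (ha : a ≠ ⊥) (hb : b ≠ ⊥) (h : a ⊓ b = ⊥) :
    LatIncomp a b :=
  ⟨fun hle => ha (by rwa [inf_eq_left.2 hle] at h), fun hle => hb (by rwa [inf_eq_right.2 hle] at h)⟩

theorem ne_bot_of_mem {F : StoneSpace L} {x : L} (h : x ∈ F.1) : x ≠ ⊥ :=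
  fun e => bot_notMem F (e ▸ h)

/-- An element `c` below `a ⊔ b` and disjoint from both lies between them. -/
theorem IsLocLattice.inf_eq (hloc : IsLocLattice L) {a b c : L} (ha : a ≠ ⊥) (hb : b ≠ ⊥)
    (hc : c ≠ ⊥) (hca : c ⊓ a = ⊥) (hcb : c ⊓ b = ⊥) (hle : c ≤ a ⊔ b) :
    (a ⊔ c) ⊓ (b ⊔ c) = c := by
  refine hloc.inf_sup_eq a b c ⟨fun h => ?_, fun h => ?_⟩
    (.of_inf_eq_bot ha hc (by rwa [inf_comm])) (.of_inf_eq_bot hb hc (by rwa [inf_comm])) hle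
  · rw [sup_eq_right.2 h] at hle
    exact hc (by rwa [inf_eq_left.2 hle] at hcb)
  · rw [sup_eq_left.2 h] at hle
    exact hc (by rwa [inf_eq_left.2 hle] at hca)

theorem exists_pairwise_disjoint (hsep : IsTotallySeparatedLattice L) {F G H : StoneSpace L}
    (hFG : F ≠ G) (hGH : G ≠ H) (hFH : F ≠ H) :
    ∃ a ∈ F.1, ∃ b ∈ G.1, ∃ c ∈ H.1, a ⊓ b = ⊥ ∧ b ⊓ c = ⊥ ∧ a ⊓ c = ⊥ := by
  obtain ⟨a, ha, b, hb, hab⟩ := hsep F G hFG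
  obtain ⟨b', hb', c, hc, hbc⟩ := hsep G H hGH
  obtain ⟨a', ha', c', hc', hac⟩ := hsep F H hFH
  refine ⟨a ⊓ a', Order.PFilter.inf_mem ha ha', b ⊓ b', Order.PFilter.inf_mem hb hb',
    c ⊓ c', Order.PFilter.inf_mem hc hc', ?_, ?_, ?_⟩ <;> rw [← le_bot_iff]
  · exact hab ▸ inf_le_inf inf_le_left inf_le_left
  · exact hbc ▸ inf_le_inf inf_le_right inf_le_left
  · exact hac ▸ inf_le_inf inf_le_right inf_le_right

/-- Totality comes from axiom (1), uniqueness from (2), and splitting from (2) and (3) together with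
semi-primality. -/
theorem IsLocLattice.isLinearBetweenness (hloc : IsLocLattice L)
    (hsep : IsTotallySeparatedLattice L) : IsLinearBetweenness (range (stoneMap (L := L))) where
  total F G H := by
    by_cases hFG : F = G
    · subst hFG
      exact Or.inl (.refl_left _ _)
    by_cases hGH : G = H
    · subst hGH
      exact Or.inl (.refl_right _ _)
    by_cases hFH : F = H
    · subst hFH
      exact Or.inr (Or.inl (.refl_right _ _))
    obtain ⟨a, ha, b, hb, c, hc, -⟩ := exists_pairwise_disjoint hsep hFG hGH hFH
    simp only [familyBetween_stoneMap_iff]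
    by_contra! hne
    obtain ⟨⟨y, hyF, hyH, hyG⟩, ⟨z, hzG, hzF, hzH⟩, ⟨x, hxH, hxG, hxF⟩⟩ := hne
    have h1 : a ⊓ (y ⊓ z) ∈ F.1 :=
      Order.PFilter.inf_mem ha (Order.PFilter.inf_mem hyF hzF)
    have h2 : b ⊓ (x ⊓ z) ∈ G.1 :=
      Order.PFilter.inf_mem hb (Order.PFilter.inf_mem hxG hzG)
    have h3 : c ⊓ (x ⊓ y) ∈ H.1 :=
      Order.PFilter.inf_mem hc (Order.PFilter.inf_mem hxH hyH)
    -- The join of any two of these lies below the witness shared by their filters, which the third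
    -- filter lacks.
    rcases hloc.le_sup_or (a ⊓ (y ⊓ z)) (b ⊓ (x ⊓ z)) (c ⊓ (x ⊓ y)) with h | h | h
    · exact hxF (Order.PFilter.mem_of_le (h.trans (sup_le (inf_le_right.trans inf_le_left)
        (inf_le_right.trans inf_le_left))) h1)
    · exact hyG (Order.PFilter.mem_of_le (h.trans (sup_le (inf_le_right.trans inf_le_left)
        (inf_le_right.trans inf_le_right))) h2)
    · exact hzH (Order.PFilter.mem_of_le (h.trans (sup_le (inf_le_right.trans inf_le_right)
        (inf_le_right.trans inf_le_right))) h3)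
  unique F G H h h' := by
    rw [familyBetween_stoneMap_iff] at h h'
    by_contra hGH
    by_cases hFG : F = G
    · subst hFG
      exact hGH (hsep.eq_of_le fun x hx => h' x hx hx)
    by_cases hFH : F = H
    · subst hFH
      exact hGH (hsep.eq_of_le fun x hx => h x hx hx).symm
    obtain ⟨a, ha, b, hb, c, hc, hab, hbc, hac⟩ := exists_pairwise_disjoint hsep hFG hGH hFH
    have hacG : a ⊔ c ∈ G.1 := h _ (Order.PFilter.mem_of_le le_sup_left ha)
      (Order.PFilter.mem_of_le le_sup_right hc)
    -- Axiom (2) recovers `b'` as `(a ⊔ b') ⊓ (c ⊔ b')`. Both factors lie in `H`, yet `b'` is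
    -- disjoint from `c ∈ H`.
    set b' := b ⊓ (a ⊔ c) with hb'
    have hb'G : b' ∈ G.1 := Order.PFilter.inf_mem hb hacG
    have hbH : a ⊔ b' ∈ H.1 := h' _ (Order.PFilter.mem_of_le le_sup_left ha)
      (Order.PFilter.mem_of_le le_sup_right hb'G)
    have hb'c : b' ⊓ c = ⊥ := le_bot_iff.1 (hbc ▸ inf_le_inf_right _ inf_le_left)
    have hb'a : b' ⊓ a = ⊥ := le_bot_iff.1 (hab ▸ (inf_le_inf_right _ inf_le_left).trans_eq
      (inf_comm _ _))
    have key := hloc.inf_eq (ne_bot_of_mem ha) (ne_bot_of_mem hc) (ne_bot_of_mem hb'G) hb'a hb'c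
      inf_le_right
    have : (a ⊔ b') ⊓ (c ⊔ b') ∈ H.1 :=
      Order.PFilter.inf_mem hbH (Order.PFilter.mem_of_le le_sup_left hc)
    rw [key] at this
    exact notMem_of_inf_eq_bot H this hb'c hc
  split F G H K h := by
    simp only [familyBetween_stoneMap_iff] at h ⊢
    by_contra! hne
    obtain ⟨⟨u, huF, huK, huG⟩, v, hvK, hvH, hvG⟩ := hne
    have huv : u ⊔ v ∈ G.1 := h _ (Order.PFilter.mem_of_le le_sup_left huF)
      (Order.PFilter.mem_of_le le_sup_right hvH)
    have hne : u ⊓ v ≠ ⊥ := ne_bot_of_mem (Order.PFilter.inf_mem huK hvK)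
    obtain ⟨x, hxG, hx, hint⟩ := ((G.2.mem_of_sup_mem u v huv).resolve_left huG).resolve_left hvG
    have hxu : ¬ x ≤ u := fun hle => huG (Order.PFilter.mem_of_le hle hxG)
    have hxv : ¬ x ≤ v := fun hle => hvG (Order.PFilter.mem_of_le hle hxG)
    -- By (3) the internal element `x` misses `u` or `v`, so it cannot dominate the nonzero `u ⊓ v`;
    -- but (2) forces `u ⊓ v ≤ x`.
    have hcase : u ⊓ x = ⊥ ∨ v ⊓ x = ⊥ := by
      by_contra! hc
      exact hint (hloc.sup_inf_eq u v x hx hc.1 hc.2)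
    have hnle : ¬ u ⊓ v ≤ x := by
      intro hle
      rcases hcase with hc | hc
      · exact hne (le_bot_iff.1 (hc ▸ le_inf inf_le_left hle))
      · exact hne (le_bot_iff.1 (hc ▸ le_inf inf_le_right hle))
    have key := hloc.inf_sup_eq u v x
      ⟨fun hle => hxv (hx.trans_eq (sup_eq_right.2 hle)),
        fun hle => hxu (hx.trans_eq (sup_eq_left.2 hle))⟩
      ⟨fun hle => hnle (inf_le_left.trans hle), hxu⟩
      ⟨fun hle => hnle (inf_le_right.trans hle), hxv⟩ hx
    exact hnle (key ▸ inf_le_inf le_sup_left le_sup_left)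

/-- The Stone map sends the join of two nonzero elements to the convex hull of their images. -/
theorem IsLocLattice.between_of_sup_mem (hloc : IsLocLattice L)
    (hsep : IsTotallySeparatedLattice L) {x y : L} {F G H : StoneSpace L} (hG : x ⊔ y ∈ G.1)
    (hx : x ∉ G.1) (hy : y ∉ G.1) (hF : x ∈ F.1) (hH : y ∈ H.1) :
    FamilyBetween (range (stoneMap (L := L))) F G H := by
  obtain ⟨c, hc, hcx⟩ := hsep.exists_inf_eq_bot hx
  obtain ⟨d, hd, hdy⟩ := hsep.exists_inf_eq_bot hy
  have he : c ⊓ d ⊓ (x ⊔ y) ∈ G.1 := Order.PFilter.inf_mem (Order.PFilter.inf_mem hc hd) hG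
  -- If `F` or `H` were the middle point, it would contain `(x ⊔ e) ⊓ (y ⊔ e) = e`, which is
  -- disjoint from `x` and `y`.
  set e := c ⊓ d ⊓ (x ⊔ y)
  have hex : e ⊓ x = ⊥ :=
    le_bot_iff.1 (hcx ▸ inf_le_inf_right _ (inf_le_left.trans inf_le_left))
  have hey : e ⊓ y = ⊥ :=
    le_bot_iff.1 (hdy ▸ inf_le_inf_right _ (inf_le_left.trans inf_le_right))
  have key := hloc.inf_eq (ne_bot_of_mem hF) (ne_bot_of_mem hH) (ne_bot_of_mem he) hex hey
    inf_le_right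
  rcases (hloc.isLinearBetweenness hsep).total F G H with h | h | h
  · exact h
  · rw [familyBetween_stoneMap_iff] at h
    have h1 := h _ (Order.PFilter.mem_of_le le_sup_right he)
      (Order.PFilter.mem_of_le (le_sup_left : x ≤ x ⊔ e) hF)
    have := Order.PFilter.inf_mem h1 (Order.PFilter.mem_of_le (le_sup_left : y ≤ y ⊔ e) hH)
    rw [key] at this
    exact absurd hH (notMem_of_inf_eq_bot H this hey)
  · rw [familyBetween_stoneMap_iff] at h
    have h1 := h _ (Order.PFilter.mem_of_le (le_sup_left : y ≤ y ⊔ e) hH)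
      (Order.PFilter.mem_of_le le_sup_right he)
    have := Order.PFilter.inf_mem (Order.PFilter.mem_of_le (le_sup_left : x ≤ x ⊔ e) hF) h1
    rw [key] at this
    exact absurd hF (notMem_of_inf_eq_bot F this hex)

end SemiPrime

/-! ### Convex representations and the interval topology. -/

section ConvexRepresentation

variable {L : Type*} [Lattice L] [OrderBot L] {X : Type*}

/-- A representation of a lattice by convex subsets of a linear order, in which joins are convex
hulls of unions and distinct points are separated by disjoint elements. -/
structure IsConvexRepresentation [LinearOrder X] (f : L → Set X) : Prop where
  subset_iff : ∀ {x y}, f x ⊆ f y ↔ x ≤ y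
  inf : ∀ x y, f (x ⊓ y) = f x ∩ f y
  nonempty_iff : ∀ {x}, (f x).Nonempty ↔ x ≠ ⊥
  ordConnected : ∀ x, (f x).OrdConnected
  exists_le : ∀ {x y p}, p ∈ f (x ⊔ y) → ∃ q ∈ f x ∪ f y, q ≤ p
  exists_ge : ∀ {x y p}, p ∈ f (x ⊔ y) → ∃ q ∈ f x ∪ f y, p ≤ q
  exists_mem : ∀ p, ∃ x, p ∈ f x
  separated : ∀ p q, p ≠ q → ∃ a b, p ∈ f a ∧ q ∈ f b ∧ a ⊓ b = ⊥

/-- Uniqueness of middle points gives the converse of consistency: betweenness for the family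
implies order betweenness. Hence joins are order-convex hulls. -/
theorem IsLocLattice.isConvexRepresentation (hloc : IsLocLattice L)
    (hsep : IsTotallySeparatedLattice L) {o : LinearOrder (StoneSpace L)}
    (ho : IsConsistentOrder (range (stoneMap (L := L))) o) :
    IsConvexRepresentation (stoneMap (L := L)) := by
  have hbet : ∀ {F G H : StoneSpace L}, FamilyBetween (range (stoneMap (L := L))) F G H →
      (F ≤ G ∧ G ≤ H) ∨ (H ≤ G ∧ G ≤ F) := by
    intro F G H h
    have hB := hloc.isLinearBetweenness hsep
    rcases le_total F G with h1 | h1 <;> rcases le_total G H with h2 | h2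
    · exact Or.inl ⟨h1, h2⟩
    · rcases le_total F H with h3 | h3
      · exact Or.inl ⟨h1, (hB.unique _ _ _ h (ho _ _ _ (Or.inl ⟨h3, h2⟩))).le⟩
      · exact Or.inr ⟨h2, (hB.unique _ _ _ h.symm (ho _ _ _ (Or.inl ⟨h3, h1⟩))).le⟩
    · rcases le_total F H with h3 | h3
      · exact Or.inl ⟨(hB.unique _ _ _ h.symm (ho _ _ _ (Or.inr ⟨h1, h3⟩))).ge, h2⟩
      · exact Or.inr ⟨(hB.unique _ _ _ h (ho _ _ _ (Or.inr ⟨h2, h3⟩))).ge, h1⟩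
    · exact Or.inr ⟨h2, h1⟩
  have hsup : ∀ {x y : L} {G : StoneSpace L}, G ∈ stoneMap (x ⊔ y) →
      ∃ p ∈ stoneMap x ∪ stoneMap y, ∃ q ∈ stoneMap x ∪ stoneMap y, p ≤ G ∧ G ≤ q := by
    intro x y G hG
    by_cases hx : x ∈ G.1
    · exact ⟨G, Or.inl hx, G, Or.inl hx, le_rfl, le_rfl⟩
    by_cases hy : y ∈ G.1
    · exact ⟨G, Or.inr hy, G, Or.inr hy, le_rfl, le_rfl⟩
    have hx0 : x ≠ ⊥ := by
      rintro rfl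
      exact hy (by simpa [stoneMap] using hG)
    have hy0 : y ≠ ⊥ := by
      rintro rfl
      exact hx (by simpa [stoneMap] using hG)
    obtain ⟨F, hF⟩ := stoneMap_nonempty_iff.2 hx0
    obtain ⟨H, hH⟩ := stoneMap_nonempty_iff.2 hy0
    rcases hbet (hloc.between_of_sup_mem hsep hG hx hy hF hH) with h | h
    · exact ⟨F, Or.inl hF, H, Or.inr hH, h.1, h.2⟩
    · exact ⟨H, Or.inr hH, F, Or.inl hF, h.1, h.2⟩
  exact
  { subset_iff := stoneMap_subset_iff
    inf := stoneMap_inf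
    nonempty_iff := stoneMap_nonempty_iff
    ordConnected := fun x => ⟨fun F hF H hH G hG =>
      ho F G H (Or.inl hG) _ (mem_range_self x) hF hH⟩
    exists_le := fun h => by
      obtain ⟨p, hp, -, -, h1, -⟩ := hsup h
      exact ⟨p, hp, h1⟩
    exists_ge := fun h => by
      obtain ⟨-, -, q, hq, -, h1⟩ := hsup h
      exact ⟨q, hq, h1⟩
    exists_mem := fun F => F.1.nonempty
    separated := fun F G h => by
      obtain ⟨a, ha, b, hb, hab⟩ := hsep F G h
      exact ⟨a, b, ha, hb, hab⟩ }

namespace IsConvexRepresentation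

variable [LinearOrder X] {f : L → Set X}

/-- Reversal swaps the two join axioms, so every one-sided result also yields its mirror image. -/
theorem dual (hf : IsConvexRepresentation f) :
    IsConvexRepresentation (X := Xᵒᵈ) (fun x => OrderDual.ofDual ⁻¹' f x) where
  subset_iff := hf.subset_iff
  inf := hf.inf
  nonempty_iff := hf.nonempty_iff
  ordConnected x := (hf.ordConnected x).dual
  exists_le := hf.exists_ge
  exists_ge := hf.exists_le
  exists_mem := hf.exists_mem
  separated := hf.separated

theorem subset_of_le (hf : IsConvexRepresentation f) {x y : L} (h : x ≤ y) : f x ⊆ f y :=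
  hf.subset_iff.2 h

/-- A convex set containing `q` and missing `p < q` lies entirely above `p`. -/
theorem exists_subset_Ioi (hf : IsConvexRepresentation f) {p q : X} (h : p < q) :
    ∃ a, q ∈ f a ∧ f a ⊆ Ioi p := by
  obtain ⟨a, b, hp, hq, hab⟩ := hf.separated p q h.ne
  have hpb : p ∉ f b := fun hpb =>
    hf.nonempty_iff.1 ⟨p, (hf.inf a b).symm ▸ ⟨hp, hpb⟩⟩ hab
  refine ⟨b, hq, fun r hr => ?_⟩
  by_contra hrp
  exact hpb ((hf.ordConnected b).out hr hq ⟨not_lt.1 hrp, h.le⟩)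

theorem exists_subset_Iio (hf : IsConvexRepresentation f) {p q : X} (h : p < q) :
    ∃ a, p ∈ f a ∧ f a ⊆ Iio q :=
  hf.dual.exists_subset_Ioi (p := OrderDual.toDual q) (q := OrderDual.toDual p) h

theorem sup_subset_of_isUpperSet (hf : IsConvexRepresentation f) {s : Set X} (hs : IsUpperSet s)
    {x y : L} (hx : f x ⊆ s) (hy : f y ⊆ s) : f (x ⊔ y) ⊆ s := by
  intro p hp
  obtain ⟨q, hq, hqp⟩ := hf.exists_le hp
  exact hs hqp (union_subset hx hy hq)

theorem sup_subset_of_isLowerSet (hf : IsConvexRepresentation f) {s : Set X} (hs : IsLowerSet s)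
    {x y : L} (hx : f x ⊆ s) (hy : f y ⊆ s) : f (x ⊔ y) ⊆ s := by
  intro p hp
  obtain ⟨q, hq, hqp⟩ := hf.exists_ge hp
  exact hs hqp (union_subset hx hy hq)

/-- An element whose image starts exactly above a nonempty lower set without maximum is
accessible from above. -/
theorem accessibleFromAbove (hf : IsConvexRepresentation f) {A : Set X} (hA : IsLowerSet A)
    (hne : A.Nonempty) (hmax : ∀ p ∈ A, ∃ q ∈ A, p < q) {x : L} (hx : x ≠ ⊥)
    (hxA : Disjoint (f x) A) (hco : ∀ q ∉ A, ∃ p ∈ f x, p ≤ q) : AccessibleFromAbove x := by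
  have hsub : ∀ {p}, p ∈ A → ∃ a, p ∈ f a ∧ f a ⊆ A := by
    intro p hp
    obtain ⟨q, hq, hpq⟩ := hmax p hp
    obtain ⟨a, ha, haq⟩ := hf.exists_subset_Iio hpq
    exact ⟨a, ha, fun r hr => hA (haq hr).le hq⟩
  -- the part of `f (x ⊔ a)` outside `A` is `f x`
  have hout : ∀ {a}, f a ⊆ A → ∀ {p}, p ∉ A → p ∈ f (x ⊔ a) → p ∈ f x := by
    intro a ha p hp hpx
    obtain ⟨q, hq, hpq⟩ := hf.exists_ge hpx
    have hq' : q ∈ f x := hq.resolve_right fun h => hp (hA hpq (ha h))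
    obtain ⟨r, hr, hrp⟩ := hco p hp
    exact (hf.ordConnected x).out hr hq' ⟨hrp, hpq⟩
  obtain ⟨p₀, hp₀⟩ := hne
  obtain ⟨r₀, hr₀⟩ := hf.nonempty_iff.2 hx
  have hr₀A : r₀ ∉ A := fun h => disjoint_left.1 hxA hr₀ h
  -- These joins extend `f x` downwards into `A`. They are nested according to how far down they
  -- reach, and they shrink to `f x` since `A` has no maximum.
  refine ⟨{y | ∃ a, a ≠ ⊥ ∧ f a ⊆ A ∧ y = x ⊔ a}, ?_, ?_, ⟨?_, ?_⟩, ?_⟩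
  · obtain ⟨a, ha, haA⟩ := hsub hp₀
    exact ⟨_, a, hf.nonempty_iff.1 ⟨_, ha⟩, haA, rfl⟩
  · have key : ∀ {a b p}, f a ⊆ A → f b ⊆ A → p ∈ f b → (∀ q ∈ f a, p ≤ q) →
        x ⊔ a ≤ x ⊔ b := by
      intro a b p ha hb hp hle
      refine sup_le le_sup_left (hf.subset_iff.1 fun q hq => ?_)
      refine (hf.ordConnected (x ⊔ b)).out (hf.subset_of_le le_sup_right hp)
        (hf.subset_of_le le_sup_left hr₀) ⟨hle q hq, ?_⟩
      exact le_of_not_ge fun h => hr₀A (hA h (ha hq))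
    rintro _ ⟨a, -, ha, rfl⟩ _ ⟨b, -, hb, rfl⟩ -
    by_cases h : ∃ p ∈ f b, ∀ q ∈ f a, p ≤ q
    · obtain ⟨p, hp, hle⟩ := h
      exact Or.inl (key ha hb hp hle)
    · push Not at h
      by_cases hb0 : b = ⊥
      · subst hb0
        exact Or.inr (sup_le le_sup_left bot_le)
      right
      by_cases h' : ∃ p ∈ f a, ∀ q ∈ f b, p ≤ q
      · obtain ⟨p, hp, hle⟩ := h'
        exact key hb ha hp hle
      · push Not at h'
        refine sup_le le_sup_left (hf.subset_iff.1 fun q hq => ?_)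
        obtain ⟨p, hp, hpq⟩ := h q hq
        refine (hf.ordConnected (x ⊔ a)).out (hf.subset_of_le le_sup_right hp)
          (hf.subset_of_le le_sup_left hr₀) ⟨hpq.le, ?_⟩
        exact le_of_not_ge fun h => hr₀A (hA h (hb hq))
  · rintro _ ⟨a, -, -, rfl⟩
    exact le_sup_left
  · intro z hz
    refine hf.subset_iff.1 fun p hp => ?_
    by_cases hpA : p ∈ A
    -- A small element around `q`, inside `A` and above `p`, gives a join whose image misses `p`.
    · obtain ⟨q, hq, hpq⟩ := hmax p hpA
      obtain ⟨a, ha, haA⟩ := hsub hq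
      obtain ⟨b, hb, hbp⟩ := hf.exists_subset_Ioi hpq
      have hbA : f (a ⊓ b) ⊆ A := (hf.subset_of_le inf_le_left).trans haA
      have hqab : q ∈ f (a ⊓ b) := (hf.inf a b).symm ▸ ⟨ha, hb⟩
      have hpz := hf.subset_of_le (hz ⟨a ⊓ b, hf.nonempty_iff.1 ⟨q, hqab⟩, hbA, rfl⟩) hp
      refine absurd (hf.sup_subset_of_isUpperSet (isUpperSet_Ioi p) ?_ ?_ hpz) (lt_irrefl p)
      · exact fun r hr => lt_of_not_ge fun h => disjoint_left.1 hxA hr (hA h hpA)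
      · exact (hf.subset_of_le inf_le_right).trans hbp
    · obtain ⟨a, ha, haA⟩ := hsub hp₀
      exact hout haA hpA (hf.subset_of_le (hz ⟨a, hf.nonempty_iff.1 ⟨_, ha⟩, haA, rfl⟩) hp)
  · rintro ⟨a, ha, haA, hxa⟩
    obtain ⟨r, hr⟩ := hf.nonempty_iff.2 ha
    exact disjoint_left.1 hxA (hf.subset_of_le (le_sup_right.trans_eq hxa.symm) hr) (haA hr)

/-- The image of an element inaccessible from above is open to the left. -/
theorem exists_Ioc_subset (hf : IsConvexRepresentation f)
    (hacc : ∀ a : L, a ≠ ⊥ → ¬ AccessibleFromAbove a) {x : L} {p : X} (hp : p ∈ f x) :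
    IsBot p ∨ ∃ q < p, Ioc q p ⊆ f x := by
  by_contra! hne
  obtain ⟨hbot, hne⟩ := hne
  simp only [IsBot, not_forall, not_le] at hbot
  have hge : ∀ q ∈ f x, p ≤ q := fun q hq => le_of_not_gt fun hqp =>
    hne q hqp fun r hr => (hf.ordConnected x).out hq hp ⟨hr.1.le, hr.2⟩
  -- Here `p` is the minimum of `f x`, and `Iio p` has no maximum `q`, since then `Ioc q p = {p}`
  -- would lie in `f x`.
  refine hacc x (hf.nonempty_iff.1 ⟨p, hp⟩) (hf.accessibleFromAbove (isLowerSet_Iio p) hbot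
    (fun q hq => ?_) (hf.nonempty_iff.1 ⟨p, hp⟩) ?_ fun q hq => ⟨p, hp, not_lt.1 hq⟩)
  · by_contra! h
    refine hne q hq fun r hr => ?_
    by_cases hrp : r < p
    · exact absurd hr.1 (h r hrp).not_gt
    · rwa [le_antisymm hr.2 (not_lt.1 hrp)]
  · exact disjoint_left.2 fun q hq hqp => (hge q hq).not_gt hqp

theorem exists_Ico_subset (hf : IsConvexRepresentation f)
    (hacc : ∀ a : L, a ≠ ⊥ → ¬ AccessibleFromAbove a) {x : L} {p : X} (hp : p ∈ f x) :
    IsTop p ∨ ∃ q > p, Ico p q ⊆ f x := by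
  rcases hf.dual.exists_Ioc_subset hacc (p := OrderDual.toDual p) hp with h | ⟨q, hq, h⟩
  · exact Or.inl h
  · exact Or.inr ⟨OrderDual.ofDual q, hq, fun r hr => @h (OrderDual.toDual r) ⟨hr.2, hr.1⟩⟩

theorem exists_openInterval_subset (hf : IsConvexRepresentation f)
    (hacc : ∀ a : L, a ≠ ⊥ → ¬ AccessibleFromAbove a) {x : L} {p : X} (hp : p ∈ f x) :
    ∃ I ∈ openIntervals X, p ∈ I ∧ I ⊆ f x := by
  rcases hf.exists_Ioc_subset hacc hp with hb | ⟨q, hq, hqs⟩ <;>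
    rcases hf.exists_Ico_subset hacc hp with ht | ⟨r, hr, hrs⟩
  · exact ⟨univ, Or.inl rfl, mem_univ p, fun s _ => le_antisymm (hb s) (ht s) ▸ hp⟩
  · exact ⟨Iio r, Or.inr (Or.inr (Or.inl ⟨r, rfl⟩)), hr, fun s hs => hrs ⟨hb s, hs⟩⟩
  · exact ⟨Ioi q, Or.inr (Or.inl ⟨q, rfl⟩), hq, fun s hs => hqs ⟨hs, ht s⟩⟩
  · refine ⟨Ioo q r, Or.inr (Or.inr (Or.inr ⟨q, r, rfl⟩)), ⟨hq, hr⟩, fun s hs => ?_⟩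
    rcases le_total s p with h | h
    · exact hqs ⟨hs.1, h⟩
    · exact hrs ⟨h, hs.2⟩

/-- Separation alone makes the rays open; inaccessibility is needed to fit an interval inside a
basic set. -/
theorem isTopologicalBasis_openIntervals (hf : IsConvexRepresentation f)
    (hacc : ∀ a : L, a ≠ ⊥ → ¬ AccessibleFromAbove a) [TopologicalSpace X]
    (hB : TopologicalSpace.IsTopologicalBasis (range f)) :
    TopologicalSpace.IsTopologicalBasis (openIntervals X) := by
  have hIoi : ∀ a : X, IsOpen (Ioi a) := fun a => hB.isOpen_iff.2 fun q hq => by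
    obtain ⟨x, hx, hxa⟩ := hf.exists_subset_Ioi hq
    exact ⟨_, mem_range_self x, hx, hxa⟩
  have hIio : ∀ a : X, IsOpen (Iio a) := fun a => hB.isOpen_iff.2 fun q hq => by
    obtain ⟨x, hx, hxa⟩ := hf.exists_subset_Iio hq
    exact ⟨_, mem_range_self x, hx, hxa⟩
  refine TopologicalSpace.isTopologicalBasis_of_isOpen_of_nhds ?_ ?_
  · rintro _ (rfl | ⟨a, rfl⟩ | ⟨a, rfl⟩ | ⟨a, b, rfl⟩)
    exacts [isOpen_univ, hIoi a, hIio a, (hIoi a).inter (hIio b)]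
  · intro p u hp hu
    obtain ⟨_, ⟨x, rfl⟩, hpx, hxu⟩ := hB.isOpen_iff.1 hu p hp
    obtain ⟨I, hI, hpI, hIx⟩ := hf.exists_openInterval_subset hacc hpx
    exact ⟨I, hI, hpI, hIx.trans hxu⟩

/-! ### Gaps, cut filters and completeness. -/

/-- The filter of elements straddling a cut. -/
def cutFilter (hf : IsConvexRepresentation f) {A : Set X} (hA : IsLowerSet A)
    (hne : A.Nonempty) (hne' : Aᶜ.Nonempty) : Order.PFilter L :=
  Order.IsPFilter.toPFilter (F := {y | (f y ∩ A).Nonempty ∧ (f y ∩ Aᶜ).Nonempty}) <| by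
    refine Order.IsPFilter.of_def ?_ ?_ ?_
    · obtain ⟨p, hp⟩ := hne
      obtain ⟨q, hq⟩ := hne'
      obtain ⟨a, ha⟩ := hf.exists_mem p
      obtain ⟨b, hb⟩ := hf.exists_mem q
      exact ⟨a ⊔ b, ⟨p, hf.subset_of_le le_sup_left ha, hp⟩,
        ⟨q, hf.subset_of_le le_sup_right hb, hq⟩⟩
    · rintro x ⟨⟨p, hp, hpA⟩, q, hq, hqA⟩ y ⟨⟨p', hp', hpA'⟩, q', hq', hqA'⟩
      have hlt : ∀ {r s}, r ∈ A → s ∉ A → r ≤ s :=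
        fun hr hs => le_of_not_ge fun h => hs (hA h hr)
      refine ⟨x ⊓ y, ?_, inf_le_left, inf_le_right⟩
      -- By convexity, the larger lower witness and the smaller upper witness lie in both images.
      have hmaxA : max p p' ∈ A := by rcases max_choice p p' with h | h <;> rwa [h]
      have hminA : min q q' ∉ A := by rcases min_choice q q' with h | h <;> rwa [h]
      refine ⟨⟨max p p', ?_, hmaxA⟩, ⟨min q q', ?_, hminA⟩⟩ <;> rw [hf.inf]
      · exact ⟨(hf.ordConnected x).out hp hq ⟨le_max_left _ _, hlt hmaxA hqA⟩,
          (hf.ordConnected y).out hp' hq' ⟨le_max_right _ _, hlt hmaxA hqA'⟩⟩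
      · exact ⟨(hf.ordConnected x).out hp hq ⟨hlt hpA hminA, min_le_left _ _⟩,
          (hf.ordConnected y).out hp' hq' ⟨hlt hpA' hminA, min_le_right _ _⟩⟩
    · rintro x y hxy ⟨h1, h2⟩
      exact ⟨h1.mono (inter_subset_inter_left _ (hf.subset_of_le hxy)),
        h2.mono (inter_subset_inter_left _ (hf.subset_of_le hxy))⟩

/-- The filter of a gap is semi-prime if no nonzero element is accessible from above. -/
theorem isSemiPrime_cutFilter (hf : IsConvexRepresentation f)
    (hacc : ∀ a : L, a ≠ ⊥ → ¬ AccessibleFromAbove a) {A : Set X} (hA : IsLowerSet A)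
    (hne : A.Nonempty) (hne' : Aᶜ.Nonempty) (hmax : ∀ p ∈ A, ∃ q ∈ A, p < q)
    (hmin : ∀ p ∈ Aᶜ, ∃ q ∈ Aᶜ, q < p) : IsSemiPrime (hf.cutFilter hA hne hne') := by
  have hbot : ⊥ ∉ hf.cutFilter hA hne hne' := fun h =>
    hf.nonempty_iff.1 (h.1.mono inter_subset_left) rfl
  -- an element below the gap and one above it have an internal element straddling the gap
  have key : ∀ {a b}, f a ⊆ A → f b ⊆ Aᶜ → a ⊔ b ∈ hf.cutFilter hA hne hne' →
      ∃ c ∈ hf.cutFilter hA hne hne', IsInternal a b c := by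
    intro a b ha hb hab
    have ha0 : a ≠ ⊥ := by
      rintro rfl
      rw [bot_sup_eq] at hab
      obtain ⟨p, hp, hpA⟩ := hab.1
      exact hb hp hpA
    -- If `f a` were cofinal in `A`, then `a` would be accessible from above, by extending it
    -- upwards across the gap.
    have hp : ∃ p ∈ A, ∀ q ∈ f a, q < p := by
      by_contra! h
      refine hacc a ha0 (hf.dual.accessibleFromAbove (A := OrderDual.ofDual ⁻¹' Aᶜ)
        hA.compl.toDual hne' hmin ha0 ?_ fun q hq => h q (not_not.1 hq))
      exact disjoint_left.2 fun r hr hr' => hr' (ha hr)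
    obtain ⟨p, hpA, hp⟩ := hp
    obtain ⟨q, hqA, hpq⟩ := hmax p hpA
    obtain ⟨r, hrA⟩ := hne'
    obtain ⟨c, hc, hcp⟩ := hf.exists_subset_Ioi hpq
    have hpr : p < r := lt_of_not_ge fun h => hrA (hA h hpA)
    obtain ⟨d, hd, hdp⟩ := hf.exists_subset_Ioi hpr
    -- `c ⊔ d` straddles the gap but stays above `p`, hence misses `a`. Were its meet with `a ⊔ b`
    -- not internal, that meet would lie below `b`, which does not reach into `A`.
    have hcd : c ⊔ d ∈ hf.cutFilter hA hne ⟨r, hrA⟩ :=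
      ⟨⟨q, hf.subset_of_le le_sup_left hc, hqA⟩, r, hf.subset_of_le le_sup_right hd, hrA⟩
    have hcdp : f (c ⊔ d) ⊆ Ioi p := hf.sup_subset_of_isUpperSet (isUpperSet_Ioi p) hcp hdp
    have he := Order.PFilter.inf_mem hcd hab
    refine ⟨_, he, inf_le_right, fun heq => ?_⟩
    have hae : a ⊓ ((c ⊔ d) ⊓ (a ⊔ b)) = ⊥ := by
      by_contra h
      obtain ⟨s, hs⟩ := hf.nonempty_iff.2 h
      exact lt_asymm (hp s (hf.subset_of_le inf_le_left hs))
        (hcdp (hf.subset_of_le (inf_le_right.trans inf_le_left) hs))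
    rw [hae, bot_sup_eq] at heq
    obtain ⟨s, hs, hsA⟩ := he.1
    exact hb (hf.subset_of_le (inf_eq_right.1 heq) hs) hsA
  have hcases : ∀ {a}, a ∉ hf.cutFilter hA hne hne' → f a ⊆ A ∨ f a ⊆ Aᶜ := by
    intro a ha
    by_contra! h
    obtain ⟨⟨p, hp, hpA⟩, q, hq, hqA⟩ := And.intro (not_subset.1 h.1) (not_subset.1 h.2)
    exact ha ⟨⟨q, hq, not_not.1 hqA⟩, p, hp, hpA⟩
  refine ⟨fun h => hbot (h ▸ mem_univ ⊥ : ⊥ ∈ (hf.cutFilter hA hne hne' : Set L)),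
    fun a b hab => ?_⟩
  by_cases ha : a ∈ hf.cutFilter hA hne hne'
  · exact Or.inl ha
  by_cases hb : b ∈ hf.cutFilter hA hne hne'
  · exact Or.inr (Or.inl hb)
  refine Or.inr (Or.inr ?_)
  rcases hcases ha with ha | ha <;> rcases hcases hb with hb | hb
  · obtain ⟨p, hp, hpA⟩ := hab.2
    exact absurd (hf.sup_subset_of_isLowerSet hA ha hb hp) hpA
  · exact key ha hb hab
  · rw [sup_comm] at hab
    obtain ⟨c, hc, hcab, hne⟩ := key hb ha hab
    exact ⟨c, hc, sup_comm b a ▸ hcab, by rwa [sup_comm]⟩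
  · obtain ⟨p, hp, hpA⟩ := hab.1
    exact absurd hpA (hf.sup_subset_of_isUpperSet hA.compl ha hb hp)

/-- No point lies in exactly the elements straddling a gap. -/
theorem exists_mem_cutFilter_notMem (hf : IsConvexRepresentation f) {A : Set X}
    (hA : IsLowerSet A) (hne : A.Nonempty) (hne' : Aᶜ.Nonempty)
    (hmax : ∀ p ∈ A, ∃ q ∈ A, p < q) {p : X} (hp : p ∈ A) :
    ∃ y ∈ hf.cutFilter hA hne hne', p ∉ f y := by
  obtain ⟨q, hqA, hpq⟩ := hmax p hp
  obtain ⟨r, hrA⟩ := hne'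
  have hpr : p < r := lt_of_not_ge fun h => hrA (hA h hp)
  obtain ⟨c, hc, hcp⟩ := hf.exists_subset_Ioi hpq
  obtain ⟨d, hd, hdp⟩ := hf.exists_subset_Ioi hpr
  refine ⟨c ⊔ d, ⟨⟨q, hf.subset_of_le le_sup_left hc, hqA⟩,
    r, hf.subset_of_le le_sup_right hd, hrA⟩, fun h => ?_⟩
  exact lt_irrefl p (hf.sup_subset_of_isUpperSet (isUpperSet_Ioi p) hcp hdp h)

end IsConvexRepresentation

end ConvexRepresentation

/-- Without a supremum, the upper bounds of `S` and their complement form a gap. Its cut filter is a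
point on one of the two sides, yet some straddling element omits that point. -/
theorem exists_isLUB_stoneSpace {L : Type*} [Lattice L] [OrderBot L]
    [LinearOrder (StoneSpace L)] (hf : IsConvexRepresentation (stoneMap (L := L)))
    (hacc : ∀ a : L, a ≠ ⊥ → ¬ AccessibleFromAbove a) {S : Set (StoneSpace L)}
    (hS : S.Nonempty) (hbdd : BddAbove S) : ∃ s, IsLUB S s := by
  by_contra! hlub
  set A : Set (StoneSpace L) := (upperBounds S)ᶜ with hAdef
  have hA : IsLowerSet A := IsUpperSet.compl fun _ _ hab ha => upperBounds_mono_mem hab ha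
  have hSA : S ⊆ A := fun s hs hsU => hlub s ⟨hsU, fun u hu => hu hs⟩
  have hne : A.Nonempty := hS.mono hSA
  have hcompl : Aᶜ = upperBounds S := compl_compl _
  have hne' : Aᶜ.Nonempty := hcompl ▸ hbdd
  have hmax : ∀ p ∈ A, ∃ q ∈ A, p < q := by
    intro p hp
    have : ∃ q ∈ S, p < q := by simpa [A, upperBounds] using hp
    obtain ⟨q, hq, hpq⟩ := this
    exact ⟨q, hSA hq, hpq⟩
  have hmin : ∀ p ∈ Aᶜ, ∃ q ∈ Aᶜ, q < p := by
    intro p hp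
    by_contra! h
    rw [hcompl] at hp h
    exact hlub p ⟨hp, h⟩
  let P : StoneSpace L := ⟨_, hf.isSemiPrime_cutFilter hacc hA hne hne' hmax hmin⟩
  by_cases hP : P ∈ A
  · obtain ⟨y, hy, hPy⟩ := hf.exists_mem_cutFilter_notMem hA hne hne' hmax hP
    exact hPy hy
  -- In the reversed order the same elements straddle the gap, with the two sides exchanged.
  · obtain ⟨y, hy, hPy⟩ := hf.dual.exists_mem_cutFilter_notMem
      (A := OrderDual.ofDual ⁻¹' Aᶜ) hA.compl.toDual hne'
      (by obtain ⟨p, hp⟩ := hne; exact ⟨OrderDual.toDual p, not_not.2 hp⟩) hmin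
      (p := OrderDual.toDual P) hP
    obtain ⟨h1, s, hs, hsA⟩ := hy
    exact hPy (⟨⟨s, hs, not_not.1 hsA⟩, h1⟩ : y ∈ hf.cutFilter hA hne hne')

theorem mainTheorem9 {L : Type*} [Lattice L] [OrderBot L]
    (hloc : IsLocLattice L) (hsep : IsTotallySeparatedLattice L)
    (hacc : ∀ a : L, a ≠ ⊥ → ¬ AccessibleFromAbove a) :
    (∃ o : LinearOrder (StoneSpace L), IsConsistentOrder (range (stoneMap (L := L))) o) ∧
    (∀ o o' : LinearOrder (StoneSpace L),
      IsConsistentOrder (range (stoneMap (L := L))) o →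
      IsConsistentOrder (range (stoneMap (L := L))) o' →
        (∀ x y, o.le x y ↔ o'.le x y) ∨ (∀ x y, o.le x y ↔ o'.le y x)) ∧
    (∀ o : LinearOrder (StoneSpace L),
      IsConsistentOrder (range (stoneMap (L := L))) o →
        @IsCompleteLinearlyOrderedSpace (StoneSpace L) (stoneTopology L) o) := by
  have hB := hloc.isLinearBetweenness hsep
  refine ⟨hB.exists_isConsistentOrder, fun o o' => hB.eq_or_eq_dual, fun o ho => ?_⟩
  have hf := hloc.isConvexRepresentation hsep ho
  exact ⟨hf.isTopologicalBasis_openIntervals hacc (isTopologicalBasis_range_stoneMap L),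
    fun S hS hbdd => exists_isLUB_stoneSpace hf hacc hS hbdd⟩
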